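/- Theorem 3.1. Let $n\ge 0$, let $u(n)$ be the Lie algebra of skew-Hermitian complex $n\times n$ matrices with the inner product $\langle x,y\rangle=-\mathrm{tr}(xy)$, let $a\in u(n)$, and let $M=\{gag^{-1} : g\in U(n)\}$ be the adjoint orbit of $a$. Let $u(n)_a=\{y\in u(n) : [y,a]=0\}$, let $u(n)_a^\perp$ be its orthogonal complement in $u(n)$, let $\mathcal S(\mathbb R,u(n)_a^\perp)$ be the space of Schwartz class maps $\mathbb R\to u(n)_a^\perp$, and let $C_a(\mathbb R,M)$ be the set of smooth paths $\gamma:\mathbb R\to M$ such that $\lim_{x\to-\infty}\gamma(x)=a$ and $\gamma_x:\mathbb R\to u(n)$ is in the Schwartz class. For every $u\in\mathcal S(\mathbb R,u(n)_a^\perp)$ there is exactly one smooth $g:\mathbb R\to U(n)$ with $g^{-1}g_x=u$ and $\lim_{x\to-\infty}g(x)=I$; put $\Psi(u)=gag^{-1}$. Then $\Psi$ is a bijection from $\mathcal S(\mathbb R,u(n)_a^\perp)$ onto $C_a(\mathbb R,M)$. Its inverse $\Phi=\Psi^{-1}: C_a(\mathbb R,M)\to\mathcal S(\mathbb R,u(n)_a^\perp)$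 is called the development map. -/

import Mathlib

open scoped Matrix.Norms.L2Operator ContDiff Topology

noncomputable section

namespace AdjointOrbit

/-- Complex `n × n` matrices, with the operator norm (the choice of norm is immaterial for
smoothness, limits and the Schwartz class). -/
abbrev Mat (n : ℕ) : Type := Matrix (Fin n) (Fin n) ℂ

/-- The unitary group `U(n)`. -/
abbrev U (n : ℕ) : Submonoid (Mat n) := Matrix.unitaryGroup (Fin n) ℂ

/-- The Lie algebra `u(n)` of skew-Hermitian matrices, a real vector space. -/
abbrev u (n : ℕ) : Submodule ℝ (Mat n) := skewAdjoint.submodule ℝ (Mat n)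

/-- The pairing `⟨x, y⟩ = -tr (x y)`, which is real-valued and positive definite on `u(n)`. -/
def pairing {n : ℕ} (x y : Mat n) : ℝ := -(Matrix.trace (x * y)).re

/-- The centralizer `u(n)_a = {y ∈ u(n) | [y, a] = 0}`. -/
def centralizer {n : ℕ} (a : Mat n) : Set (Mat n) := {y | y ∈ u n ∧ ⁅y, a⁆ = 0}

/-- The orthogonal complement `u(n)_a^⊥` of the centralizer in `u(n)`. -/
def perp {n : ℕ} (a : Mat n) : Submodule ℝ (Mat n) where
  carrier := {y | y ∈ u n ∧ ∀ z ∈ centralizer a, pairing y z = 0}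
  zero_mem' := ⟨zero_mem _, fun z _ => by simp [pairing]⟩
  add_mem' := by
    rintro x y ⟨hx, hx'⟩ ⟨hy, hy'⟩
    refine ⟨add_mem hx hy, fun z hz => ?_⟩
    have h1 := hx' z hz
    have h2 := hy' z hz
    simp only [pairing, add_mul, Matrix.trace_add, Complex.add_re] at h1 h2 ⊢
    linarith
  smul_mem' := by
    rintro c x ⟨hx, hx'⟩
    refine ⟨Submodule.smul_mem _ c hx, fun z hz => ?_⟩
    have h1 := hx' z hz
    simp only [pairing, Matrix.smul_mul, Matrix.trace_smul, Complex.smul_re, smul_eq_mul] at h1 ⊢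
    rw [← mul_neg, h1, mul_zero]

/-- The space `S(ℝ, u(n)_a^⊥)` of Schwartz maps. -/
abbrev SchwartzPerp {n : ℕ} (a : Mat n) : Type := SchwartzMap ℝ (perp a)

/-- The adjoint `U(n)`-orbit of `a`. -/
def orbit {n : ℕ} (a : Mat n) : Set (Mat n) :=
  {y | ∃ g : U n, y = (g : Mat n) * a * ((g⁻¹ : U n) : Mat n)}

/-- The space `C_a(ℝ, M)` of smooth paths `γ` in the adjoint orbit `M` of `a` such that
`γ(-∞) = a` and `γ_x` is in the Schwartz class. -/
def pathSpace {n : ℕ} (a : Mat n) : Set (ℝ → Mat n) :=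
  {γ | (∀ x, γ x ∈ orbit a) ∧ ContDiff ℝ ∞ γ ∧ Filter.Tendsto γ Filter.atBot (𝓝 a) ∧
    ∃ s : SchwartzMap ℝ (u n), ∀ x, deriv γ x = s x}

/-- `g : ℝ → U(n)` is a smooth solution of `g⁻¹ g_x = v` with `g(-∞) = I`. -/
def IsFrame {n : ℕ} (v : ℝ → Mat n) (g : ℝ → U n) : Prop :=
  ContDiff ℝ ∞ (fun x => (g x : Mat n)) ∧
  (∀ x, (((g x)⁻¹ : U n) : Mat n) * deriv (fun y => (g y : Mat n)) x = v x) ∧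
  Filter.Tendsto (fun x => (g x : Mat n)) Filter.atBot (𝓝 1)

/-- The solution of `g⁻¹ g_x = v`, `g(-∞) = I` (meaningful when there is exactly one). -/
def frame {n : ℕ} (v : ℝ → Mat n) : ℝ → U n := Classical.epsilon (IsFrame v)

/-- The map `Ψ(v) = g a g⁻¹`. -/
def Psi {n : ℕ} (a : Mat n) (v : SchwartzPerp a) : ℝ → Mat n := fun x =>
  (frame (fun y => (v y : Mat n)) x : Mat n) * a *
    (((frame (fun y => (v y : Mat n)) x)⁻¹ : U n) : Mat n)

/-- The development map `Φ`, the inverse of `Ψ` (meaningful on the range of `Ψ` when `Ψ` is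
injective). -/
def developmentMap {n : ℕ} (a : Mat n) : (ℝ → Mat n) → SchwartzPerp a :=
  Function.invFun (Psi a)

end AdjointOrbit

end

/-! A Schwartz generator decays like `1 / (1 + x²)`, so `g' = g v`, `g(-∞) = 1` is solved by a
contraction in a weighted sup norm (`exists_hasDerivAt_mul_tendsto_one`). Skewness of `v` makes the
solution unitary and unique. Since `g` has temperate growth, `(g a g⁻¹)' = g [v, a] g⁻¹` is
Schwartz, so `Psi` lands in `pathSpace`.

Injectivity (`IsFrame.eq_of_conj_eq`): if two frames give the same path, `k = g₁⁻¹ g₂` commutes with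
`a`, hence so does `k⁻¹ k' = v₂ - k⁻¹ v₁ k`. Both terms on the right are orthogonal to the
centralizer, so `k' = 0` and `k = 1`.

Surjectivity (`exists_isFrame_of_mem_pathSpace`) is Kato's parallel transport. The spectral
projections `P i` of `γ` are fixed polynomials in `γ`, and `w = ∑ P_i' P_i` is skew with `[w, γ] =
γ'`. Transport along `w` carries `a` to `γ`; the generator is orthogonal to the centralizer because
`P_i w P_i = 0`. -/

namespace AdjointOrbit

/-! ### Linear equations on the line with initial value at `-∞`. -/

section LinearODE

open MeasureTheory Set Filter

theorem hasDerivAt_integral_Iic {E : Type*} [NormedAddCommGroup E] [NormedSpace ℝ E]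
    [CompleteSpace E] {f : ℝ → E} (hf : Continuous f) (hi : Integrable f) (x : ℝ) :
    HasDerivAt (fun y => ∫ t in Iic y, f t) (f x) x := by
  have h : (fun y => ∫ t in Iic y, f t) =
      fun y => (∫ t in Iic (0 : ℝ), f t) + ∫ t in (0 : ℝ)..y, f t := by
    funext y
    rw [← intervalIntegral.integral_Iic_sub_Iic hi.integrableOn hi.integrableOn]
    abel
  rw [h]
  exact (hf.integral_hasStrictDerivAt 0 x).hasDerivAt.const_add _

theorem integrable_mul_of_norm_le {A : Type*} [NormedRing A] {f v : ℝ → A} {B C : ℝ} (hf : Continuous f)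
    (hB : ∀ x, ‖f x‖ ≤ B) (hv : Continuous v) (hC : ∀ x, ‖v x‖ ≤ C * (1 + x ^ 2)⁻¹) :
    Integrable fun x => f x * v x := by
  refine ((integrable_inv_one_add_sq.const_mul C).const_mul B).mono'
    (hf.mul hv).aestronglyMeasurable (Eventually.of_forall fun x => ?_)
  exact (norm_mul_le _ _).trans
    (mul_le_mul (hB x) (hC x) (norm_nonneg _) ((norm_nonneg _).trans (hB x)))

variable {A : Type*} [NormedRing A] [NormedAlgebra ℝ A]

/-- The exponential weight for which the integral operator of `g' = g v` is a contraction. -/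
noncomputable def expWeight (C x : ℝ) : ℝ := Real.exp (2 * C * Real.arctan x)

theorem hasDerivAt_expWeight (C x : ℝ) :
    HasDerivAt (expWeight C) (expWeight C x * (2 * C * (1 + x ^ 2)⁻¹)) x := by
  have h := ((Real.hasDerivAt_arctan x).const_mul (2 * C)).exp
  simpa [expWeight, one_div] using! h

theorem continuous_expWeight (C : ℝ) : Continuous (expWeight C) :=
  continuous_iff_continuousAt.2 fun x => (hasDerivAt_expWeight C x).continuousAt

theorem expWeight_pos (C x : ℝ) : 0 < expWeight C x := Real.exp_pos _

theorem expWeight_le {C : ℝ} (hC : 0 ≤ C) (x : ℝ) : expWeight C x ≤ Real.exp (C * Real.pi) := by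
  refine Real.exp_le_exp.2 ?_
  nlinarith [Real.arctan_lt_pi_div_two x]

theorem le_expWeight {C : ℝ} (hC : 0 ≤ C) (x : ℝ) : Real.exp (-(C * Real.pi)) ≤ expWeight C x := by
  refine Real.exp_le_exp.2 ?_
  nlinarith [Real.neg_pi_div_two_lt_arctan x]

theorem integrable_expWeight {C : ℝ} (hC : 0 ≤ C) :
    Integrable fun x => expWeight C x * (2 * C * (1 + x ^ 2)⁻¹) :=
  integrable_mul_of_norm_le (continuous_expWeight C)
    (fun x => by rw [Real.norm_of_nonneg (expWeight_pos C x).le]; exact expWeight_le hC x)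
    (by fun_prop (disch := intro x; positivity))
    (C := 2 * C) (fun x => by rw [Real.norm_of_nonneg (by positivity)])

/-- The integrand is the derivative of the weight, whose limit at `-∞` is positive. -/
theorem integral_Iic_expWeight_le {C : ℝ} (hC : 0 ≤ C) (x : ℝ) :
    ∫ t in Iic x, expWeight C t * (2 * C * (1 + t ^ 2)⁻¹) ≤ expWeight C x := by
  have hlim : Tendsto (expWeight C) atBot (𝓝 (Real.exp (2 * C * (-(Real.pi / 2))))) :=
    (Real.continuous_exp.tendsto _).comp
      ((tendsto_nhds_of_tendsto_nhdsWithin Real.tendsto_arctan_atBot).const_mul _)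
  rw [integral_Iic_of_hasDerivAt_of_tendsto' (fun t _ => hasDerivAt_expWeight C t)
    (integrable_expWeight hC).integrableOn hlim]
  linarith [Real.exp_pos (2 * C * (-(Real.pi / 2)))]

/-- The linear equation `g' = g v` with `g(-∞) = 1` and `v = O(1 / (1 + x²))` has a global
solution. -/
theorem exists_hasDerivAt_mul_tendsto_one [CompleteSpace A] {v : ℝ → A} {C : ℝ} (hC : 0 ≤ C)
    (hv : Continuous v) (hvC : ∀ x, ‖v x‖ ≤ C * (1 + x ^ 2)⁻¹) :
    ∃ g : ℝ → A, (∀ x, HasDerivAt g (g x * v x) x) ∧ Tendsto g atBot (𝓝 1) := by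
  set w := expWeight C with hw
  have hwc : Continuous w := continuous_expWeight C
  have hw0 : ∀ x, w x ≠ 0 := fun x => (expWeight_pos C x).ne'
  have hbd : ∀ (k : BoundedContinuousFunction ℝ A) (x : ℝ),
      ‖w x • k x‖ ≤ Real.exp (C * Real.pi) * ‖k‖ := fun k x => by
    rw [norm_smul, Real.norm_of_nonneg (expWeight_pos C x).le]
    exact mul_le_mul (expWeight_le hC x) (k.norm_coe_le_norm x) (norm_nonneg _) (Real.exp_pos _).le
  have hint : ∀ k : BoundedContinuousFunction ℝ A, Integrable fun x => (w x • k x) * v x :=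
    fun k => integrable_mul_of_norm_le (hwc.smul k.continuous) (hbd k) hv hvC
  have hder : ∀ (k : BoundedContinuousFunction ℝ A) (x : ℝ),
      HasDerivAt (fun y => 1 + ∫ t in Iic y, (w t • k t) * v t) ((w x • k x) * v x) x :=
    fun k x => (hasDerivAt_integral_Iic ((hwc.smul k.continuous).mul hv) (hint k) x).const_add 1
  -- Substituting `g = w • k` in `g = 1 + ∫ g v` gives `k = S k`; boundedness survives because `w`
  -- lies between two positive constants.
  let S : BoundedContinuousFunction ℝ A → BoundedContinuousFunction ℝ A := fun k =>
    BoundedContinuousFunction.ofNormedAddCommGroup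
      (fun x => (w x)⁻¹ • (1 + ∫ t in Iic x, (w t • k t) * v t))
      ((hwc.inv₀ hw0).smul
        (continuous_iff_continuousAt.2 fun x => (hder k x).continuousAt))
      (Real.exp (C * Real.pi) * (‖(1 : A)‖ + ∫ t, ‖(w t • k t) * v t‖)) (fun x => by
        rw [norm_smul, norm_inv, Real.norm_of_nonneg (expWeight_pos C x).le]
        refine mul_le_mul ?_ ?_ (norm_nonneg _) (Real.exp_pos _).le
        · rw [inv_le_comm₀ (expWeight_pos C x) (Real.exp_pos _), ← Real.exp_neg]
          exact le_expWeight hC x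
        · refine (norm_add_le _ _).trans (add_le_add le_rfl ?_)
          refine (norm_integral_le_integral_norm _).trans ?_
          exact setIntegral_le_integral (hint k).norm (Eventually.of_forall fun _ => norm_nonneg _))
  have hS : ∀ k x, S k x = (w x)⁻¹ • (1 + ∫ t in Iic x, (w t • k t) * v t) := fun _ _ => rfl
  have hcontr : ContractingWith (1 / 2) S := by
    refine ⟨by norm_num, LipschitzWith.of_dist_le_mul fun k l => ?_⟩
    refine (BoundedContinuousFunction.dist_le (by positivity)).2 fun x => ?_
    have hsub : S k x - S l x = (w x)⁻¹ • ∫ t in Iic x, (w t • (k t - l t)) * v t := by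
      rw [hS, hS, ← smul_sub, add_sub_add_left_eq_sub,
        ← integral_sub (hint k).integrableOn (hint l).integrableOn]
      simp only [smul_sub, sub_mul]
    -- The logarithmic derivative of `w` is twice the bound on `v`; this is the source of the factor
    -- `1 / 2`.
    have hle : ‖∫ t in Iic x, (w t • (k t - l t)) * v t‖ ≤ dist k l / 2 * w x := by
      calc ‖∫ t in Iic x, (w t • (k t - l t)) * v t‖
          ≤ ∫ t in Iic x, dist k l / 2 * (w t * (2 * C * (1 + t ^ 2)⁻¹)) := by
            refine norm_integral_le_of_norm_le
              ((integrable_expWeight hC).const_mul _).integrableOn (Eventually.of_forall fun t => ?_)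
            refine (norm_mul_le _ _).trans ?_
            rw [norm_smul, Real.norm_of_nonneg (expWeight_pos C t).le, ← dist_eq_norm]
            calc w t * dist (k t) (l t) * ‖v t‖
                ≤ w t * dist k l * (C * (1 + t ^ 2)⁻¹) := by
                  have h0 := (expWeight_pos C t).le
                  exact mul_le_mul (mul_le_mul_of_nonneg_left
                    (BoundedContinuousFunction.dist_coe_le_dist t) h0) (hvC t) (norm_nonneg _)
                    (mul_nonneg h0 dist_nonneg)
              _ = _ := by ring
        _ ≤ _ := by
            rw [integral_const_mul]
            exact mul_le_mul_of_nonneg_left (integral_Iic_expWeight_le hC x)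
              (by positivity)
    rw [dist_eq_norm, hsub, norm_smul, norm_inv, Real.norm_of_nonneg (expWeight_pos C x).le]
    calc (w x)⁻¹ * ‖∫ t in Iic x, (w t • (k t - l t)) * v t‖
        ≤ (w x)⁻¹ * (dist k l / 2 * w x) :=
          mul_le_mul_of_nonneg_left hle (inv_nonneg.2 (expWeight_pos C x).le)
      _ = _ := by
          have := hw0 x
          push_cast
          field_simp
  set k := hcontr.fixedPoint S with hk
  have hfix : ∀ x, w x • k x = 1 + ∫ t in Iic x, (w t • k t) * v t := fun x => by
    have h : S k = k := hcontr.fixedPoint_isFixedPt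
    conv_lhs => rw [← h, hS, smul_inv_smul₀ (hw0 x)]
  refine ⟨fun x => w x • k x, fun x => ?_, ?_⟩
  · have h := hder k x
    rwa [← funext hfix] at h
  · rw [funext hfix]
    simpa using (tendsto_integral_Iic_zero (μ := volume)
      (f := fun t => (w t • k t) * v t) tendsto_id).const_add (1 : A)

end LinearODE

/-! ### Temperate growth of solutions. -/

section TemperateGrowth

variable {E : Type*} [NormedAddCommGroup E] [NormedSpace ℝ E]

theorem hasTemperateGrowth_of_deriv {f : ℝ → E} {C : ℝ} (hf : Differentiable ℝ f)
    (hC : ∀ x, ‖f x‖ ≤ C) (h : (deriv f).HasTemperateGrowth) : f.HasTemperateGrowth := by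
  have h' : (fderiv ℝ f).HasTemperateGrowth := by
    have : fderiv ℝ f = fun x => 
        ContinuousLinearMap.toSpanSingletonCLE (𝕜 := ℝ) (E := E) (deriv f x) := by
      funext x
      ext
      simp
    rw [this]
    exact (ContinuousLinearEquiv.hasTemperateGrowth _).comp h
  exact h'.of_fderiv hf (k := 0) (C := C) (by simpa using hC)

variable {A : Type*} [NormedRing A] [NormedAlgebra ℝ A]

/-- Bootstrapping: derivative `n + 1` of `g` is derivative `n` of `g v`, which the Leibniz rule
bounds by lower derivatives of `g`. -/
theorem hasTemperateGrowth_of_hasDerivAt_mul {g v : ℝ → A} {C : ℝ} (hC : ∀ x, ‖g x‖ ≤ C)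
    (hg : ∀ x, HasDerivAt g (g x * v x) x) (hv : v.HasTemperateGrowth) : g.HasTemperateGrowth := by
  have hd : deriv g = fun x => g x * v x := funext fun x => (hg x).deriv
  have hdiff : Differentiable ℝ g := fun x => (hg x).differentiableAt
  have hsm : ∀ m : ℕ, ContDiff ℝ m g := fun m => by
    induction m with
    | zero => exact contDiff_zero.2 hdiff.continuous
    | succ m ih =>
      rw [Nat.cast_succ]
      refine contDiff_succ_iff_deriv.2
        ⟨hdiff, fun h => absurd h (WithTop.coe_ne_top), ?_⟩
      rw [hd]
      exact ih.mul (hv.1.of_le (mod_cast le_top))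
  have hsm' : ContDiff ℝ ∞ g := contDiff_infty.2 hsm
  refine Function.hasTemperateGrowth_iff_isBigO.2 ⟨hsm', fun n => ?_⟩
  induction n using Nat.strong_induction_on with
  | _ n ih =>
    cases n with
    | zero =>
      refine ⟨0, Asymptotics.isBigO_top.2 ⟨C, fun x => by simpa using hC x⟩⟩
    | succ n =>
      choose! k hk using ih
      choose l hl using hv.isBigO
      let K := (Finset.range (n + 1)).sup fun i => k i + l (n - i)
      refine ⟨K, ?_⟩
      have estimate : ∀ x, ‖iteratedFDeriv ℝ (n + 1) g x‖ ≤ ∑ i ∈ Finset.range (n + 1),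
          (n.choose i : ℝ) * ‖iteratedFDeriv ℝ i g x‖ * ‖iteratedFDeriv ℝ (n - i) v x‖ := fun x => by
        rw [norm_iteratedFDeriv_eq_norm_iteratedDeriv, iteratedDeriv_succ', hd,
          ← norm_iteratedFDeriv_eq_norm_iteratedDeriv]
        exact norm_iteratedFDeriv_mul_le hsm' hv.1 x (mod_cast le_top)
      refine (Asymptotics.IsBigO.of_norm_le estimate).trans (.fun_sum fun i hi => ?_)
      have hin : i < n + 1 := Finset.mem_range.1 hi
      simp_rw [mul_assoc]
      refine .const_mul_left (((hk i hin).norm_left.mul (hl (n - i)).norm_left).trans ?_) _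
      refine Asymptotics.isBigO_of_le _ fun x => ?_
      have h1 : 1 ≤ 1 + ‖x‖ := le_add_of_nonneg_right (norm_nonneg x)
      have h0 : 0 ≤ 1 + ‖x‖ := zero_le_one.trans h1
      rw [← pow_add, Real.norm_of_nonneg (pow_nonneg h0 _), Real.norm_of_nonneg (pow_nonneg h0 _)]
      exact pow_le_pow_right₀ h1 (Finset.le_sup (f := fun i => k i + l (n - i)) hi)

end TemperateGrowth

/-! ### Calculus of Schwartz functions. -/

section IsSchwartz

variable {E F : Type*} [NormedAddCommGroup E] [NormedSpace ℝ E]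
  [NormedAddCommGroup F] [NormedSpace ℝ F]

/-- The function `f` is in the Schwartz class. -/
def IsSchwartz (f : ℝ → E) : Prop := ∃ s : SchwartzMap ℝ E, ∀ x, f x = s x

namespace IsSchwartz

theorem of_schwartzMap (s : SchwartzMap ℝ E) : IsSchwartz (s : ℝ → E) := ⟨s, fun _ => rfl⟩

theorem hasTemperateGrowth {f : ℝ → E} (hf : IsSchwartz f) : f.HasTemperateGrowth := by
  obtain ⟨s, hs⟩ := hf
  rw [funext hs]
  exact s.hasTemperateGrowth

theorem add {f g : ℝ → E} (hf : IsSchwartz f) (hg : IsSchwartz g) :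
    IsSchwartz fun x => f x + g x := by
  obtain ⟨s, hs⟩ := hf
  obtain ⟨t, ht⟩ := hg
  exact ⟨s + t, fun x => by simp [hs, ht]⟩

theorem zero : IsSchwartz fun _ : ℝ => (0 : E) := ⟨0, fun _ => rfl⟩

theorem sum {ι : Type*} {S : Finset ι} {f : ι → ℝ → E} (hf : ∀ i ∈ S, IsSchwartz (f i)) :
    IsSchwartz fun x => ∑ i ∈ S, f i x := by
  classical
  induction S using Finset.induction_on with
  | empty => simpa using zero
  | insert i S hi ih =>
    simp only [Finset.sum_insert hi]
    exact (hf i (Finset.mem_insert_self i S)).add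
      (ih fun j hj => hf j (Finset.mem_insert_of_mem hj))

theorem clm (L : E →L[ℝ] F) {f : ℝ → E} (hf : IsSchwartz f) : IsSchwartz fun x => L (f x) := by
  obtain ⟨s, hs⟩ := hf
  exact ⟨s.postcompCLM L, fun x => by simp [hs]⟩

theorem mul_right {A : Type*} [NormedRing A] [NormedAlgebra ℝ A] {f g : ℝ → A}
    (hf : IsSchwartz f) (hg : g.HasTemperateGrowth) : IsSchwartz fun x => f x * g x := by
  obtain ⟨s, hs⟩ := hf
  exact ⟨SchwartzMap.bilinLeftCLM (ContinuousLinearMap.mul ℝ A) hg s, fun x => by simp [hs]⟩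

theorem mul_left {A : Type*} [NormedRing A] [NormedAlgebra ℝ A] {f g : ℝ → A}
    (hf : IsSchwartz f) (hg : g.HasTemperateGrowth) : IsSchwartz fun x => g x * f x := by
  obtain ⟨s, hs⟩ := hf
  exact ⟨SchwartzMap.bilinLeftCLM (ContinuousLinearMap.mul ℝ A).flip hg s, fun x => by simp [hs]⟩

theorem norm_le {f : ℝ → E} (hf : IsSchwartz f) :
    ∃ C, 0 ≤ C ∧ ∀ x, ‖f x‖ ≤ C * (1 + x ^ 2)⁻¹ := by
  obtain ⟨s, hs⟩ := hf
  refine ⟨SchwartzMap.seminorm ℝ 0 0 s + SchwartzMap.seminorm ℝ 2 0 s, by positivity, fun x => ?_⟩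
  have h0 := SchwartzMap.norm_pow_mul_le_seminorm ℝ s 0 x
  have h2 := SchwartzMap.norm_pow_mul_le_seminorm ℝ s 2 x
  rw [← div_eq_mul_inv, le_div_iff₀ (by positivity), hs]
  simp only [Real.norm_eq_abs, sq_abs, pow_zero, one_mul] at h0 h2
  nlinarith

/-- In finite dimension a Schwartz function with values in a subspace is a Schwartz function
into the subspace. -/
theorem codRestrict [FiniteDimensional ℝ E] (p : Submodule ℝ E) {f : ℝ → E} (hf : IsSchwartz f)
    (hp : ∀ x, f x ∈ p) : ∃ s : SchwartzMap ℝ p, ∀ x, f x = s x := by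
  -- A linear projection onto `p` is continuous here, and composing with it does not change the
  -- values of `f`.
  obtain ⟨P, hP⟩ := p.subtype.exists_leftInverse_of_injective p.ker_subtype
  obtain ⟨s, hs⟩ := hf.clm P.toContinuousLinearMap
  refine ⟨s, fun x => ?_⟩
  have h : P (f x) = ⟨f x, hp x⟩ := LinearMap.congr_fun hP ⟨f x, hp x⟩
  rw [← hs x]
  simp [h]

end IsSchwartz

end IsSchwartz

theorem eq_of_hasDerivAt_zero_of_tendsto {E : Type*} [NormedAddCommGroup E] [NormedSpace ℝ E]
    {f : ℝ → E} {c : E} (hf : ∀ x, HasDerivAt f 0 x) (hc : Filter.Tendsto f Filter.atBot (𝓝 c))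
    (x : ℝ) : f x = c := by
  have h : f = fun _ => f x := funext fun y =>
    is_const_of_deriv_eq_zero (fun y => (hf y).differentiableAt) (fun y => (hf y).deriv) y x
  rw [h] at hc
  exact tendsto_nhds_unique tendsto_const_nhds hc

/-! ### Algebra of Kato's generator, with `p'` standing for the derivative of `p`. -/

section Kato

variable {R ι : Type*} [Ring R] [DecidableEq ι] {S : Finset ι} {p p' : ι → R}

theorem kato_mul (hpp : ∀ i ∈ S, ∀ j ∈ S, p i * p j = if i = j then p i else 0) {i : ι}
    (hi : i ∈ S) : (∑ j ∈ S, p' j * p j) * p i = p' i * p i := by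
  rw [Finset.sum_mul, Finset.sum_congr rfl fun j hj => by rw [mul_assoc, hpp j hj i hi]]
  simp [hi]

/-- `hd` is the differentiated orthogonality relation. It moves the prime from `p j` to `p i`, after
which the sum collapses by `∑ p j = 1`. -/
theorem mul_kato (hpp : ∀ i ∈ S, ∀ j ∈ S, p i * p j = if i = j then p i else 0)
    (hsum : ∑ i ∈ S, p i = 1)
    (hd : ∀ i ∈ S, ∀ j ∈ S, p' i * p j + p i * p' j = if i = j then p' i else 0) {i : ι}
    (hi : i ∈ S) : p i * (∑ j ∈ S, p' j * p j) = p' i * p i - p' i := by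
  have h : ∀ j ∈ S, p i * (p' j * p j) = (if i = j then p' i * p i else 0) - p' i * p j := by
    intro j hj
    rw [← mul_assoc, eq_sub_of_add_eq' (hd i hi j hj), sub_mul, mul_assoc, hpp j hj j hj,
      if_pos rfl]
    split_ifs with hij <;> simp [hij]
  rw [Finset.mul_sum, Finset.sum_congr rfl h, Finset.sum_sub_distrib, ← Finset.mul_sum, hsum]
  simp [hi]

/-- The commutator of Kato's generator `∑ p_j' p_j` with the projection `p_i` is `p_i'`. -/
theorem kato_commutator (hpp : ∀ i ∈ S, ∀ j ∈ S, p i * p j = if i = j then p i else 0)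
    (hsum : ∑ i ∈ S, p i = 1)
    (hd : ∀ i ∈ S, ∀ j ∈ S, p' i * p j + p i * p' j = if i = j then p' i else 0) {i : ι}
    (hi : i ∈ S) :
    (∑ j ∈ S, p' j * p j) * p i - p i * (∑ j ∈ S, p' j * p j) = p' i := by
  rw [kato_mul hpp hi, mul_kato hpp hsum hd hi, sub_sub_cancel]

/-- Multiplying `p' p + p p' = p'` by `p` on the left gives `p p' p = 0`. -/
theorem kato_diagonal (hpp : ∀ i ∈ S, ∀ j ∈ S, p i * p j = if i = j then p i else 0)
    (hd : ∀ i ∈ S, ∀ j ∈ S, p' i * p j + p i * p' j = if i = j then p' i else 0) {i : ι}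
    (hi : i ∈ S) : p i * (∑ j ∈ S, p' j * p j) * p i = 0 := by
  have h1 := congrArg (p i * ·) (hd i hi i hi)
  have h2 := hpp i hi i hi
  simp only [if_true, mul_add, ← mul_assoc] at h1 h2
  rw [h2, add_eq_right] at h1
  rw [mul_assoc, kato_mul hpp hi, ← mul_assoc, h1]

/-- The sum plus its adjoint is `∑ (p' p + p p') = ∑ p' = 0`. -/
theorem star_kato [StarRing R] (hd : ∀ i ∈ S, ∀ j ∈ S,
      p' i * p j + p i * p' j = if i = j then p' i else 0)
    (hs : ∀ i ∈ S, star (p i) = p i) (hs' : ∀ i ∈ S, star (p' i) = p' i)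
    (hsum : ∑ i ∈ S, p' i = 0) :
    star (∑ j ∈ S, p' j * p j) = -∑ j ∈ S, p' j * p j := by
  rw [star_sum, ← add_eq_zero_iff_eq_neg, ← Finset.sum_add_distrib, ← hsum]
  refine Finset.sum_congr rfl fun i hi => ?_
  have := hd i hi i hi
  rw [if_pos rfl] at this
  rw [star_mul, hs i hi, hs' i hi, add_comm, this]

end Kato

variable {n : ℕ}

theorem mem_u_iff {y : Mat n} : y ∈ u n ↔ star y = -y := Iff.rfl

theorem coe_inv_unitary (g : U n) : ((g⁻¹ : U n) : Mat n) = star (g : Mat n) := rfl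

theorem star_mul_self_unitary (g : U n) : star (g : Mat n) * g = 1 := Unitary.coe_star_mul_self g

theorem mul_star_self_unitary (g : U n) : (g : Mat n) * star (g : Mat n) = 1 :=
  Unitary.coe_mul_star_self g

theorem exists_norm_unitary_le (n : ℕ) : ∃ C : ℝ, ∀ g : U n, ‖(g : Mat n)‖ ≤ C :=
  ⟨‖(1 : Mat n)‖, fun g => by
    have h := CStarRing.norm_coe_unitary_mul (E := Mat n) g 1
    rw [mul_one] at h
    exact h.le⟩

/-! ### Spectral projections as polynomials. -/

section Spectral

open Polynomial in
/-- The spectral projections of a skew-Hermitian matrix are polynomials in the matrix. -/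
theorem exists_spectral_polynomials {a : Mat n} (ha : a ∈ u n) :
    ∃ (S : Finset ℂ) (l : ℂ → ℂ[X]),
      (∀ i ∈ S, ∀ j ∈ S, aeval a (l i) * aeval a (l j) = if i = j then aeval a (l i) else 0) ∧
      (∀ i ∈ S, star (aeval a (l i)) = aeval a (l i)) ∧
      ∑ i ∈ S, aeval a (l i) = 1 ∧ ∑ i ∈ S, i • aeval a (l i) = a := by
  have hH : (Complex.I • a).IsHermitian := by
    change star (Complex.I • a) = _
    rw [star_smul, mem_u_iff.1 ha]
    simp
  let e : Fin n → ℂ := fun i => -Complex.I * hH.eigenvalues i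
  let φ : Mat n ≃⋆ₐ[ℂ] Mat n := Unitary.conjStarAlgAut ℂ (Mat n) hH.eigenvectorUnitary
  -- Matrices diagonal in an eigenbasis of `a`, as an algebra of functions: polynomials in `a` are
  -- then evaluated pointwise on the eigenvalues.
  let ψ : (Fin n → ℂ) →ₐ[ℂ] Mat n :=
    (φ.toAlgEquiv : Mat n →ₐ[ℂ] Mat n).comp (Matrix.diagonalAlgHom ℂ)
  have hψ : ∀ f, ψ f = φ (Matrix.diagonal f) := fun _ => rfl
  have hψa : ψ e = a := by
    have h1 : e = -Complex.I • (RCLike.ofReal ∘ hH.eigenvalues : Fin n → ℂ) := by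
      funext i; simp [e]
    rw [h1, map_smul, hψ, ← hH.spectral_theorem, smul_smul]
    simp
  -- Indexing by distinct eigenvalues merges multiplicities, so the Lagrange basis yields
  -- projections onto full eigenspaces.
  let S : Finset ℂ := Finset.univ.image e
  have he : ∀ i, e i ∈ S := fun i => Finset.mem_image_of_mem e (Finset.mem_univ i)
  let l : ℂ → ℂ[X] := fun i => Lagrange.basis S id i
  have hl : ∀ i ∈ S, aeval a (l i) = ψ (fun k => if i = e k then 1 else 0) := by
    intro i hi
    rw [← hψa, aeval_algHom_apply]
    congr 1
    funext k
    rw [aeval_fn_apply, coe_aeval_eq_eval]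
    split_ifs with h
    · rw [← h]
      exact Lagrange.eval_basis_self (v := id) Function.injective_id.injOn hi
    · exact Lagrange.eval_basis_of_ne (v := id) h (he k)
  refine ⟨S, l, fun i hi j hj => ?_, fun i hi => ?_, ?_, ?_⟩
  · rw [hl i hi, hl j hj, ← map_mul]
    split_ifs with hij
    · congr 1; funext k; simp [hij]
    · rw [← map_zero ψ]
      congr 1; funext k
      by_cases h : i = e k
      · simp [← h, Ne.symm hij]
      · simp [h]
  · rw [hl i hi, hψ, ← map_star]
    congr 1
    rw [Matrix.star_eq_conjTranspose, Matrix.diagonal_conjTranspose]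
    congr 1; funext k
    simp only [Pi.star_apply]
    split_ifs <;> simp
  · rw [Finset.sum_congr rfl hl, ← map_sum, ← map_one ψ]
    congr 1; funext k
    simp [he]
  · rw [Finset.sum_congr rfl fun i hi => by rw [hl i hi, ← map_smul], ← map_sum]
    conv_rhs => rw [← hψa]
    congr 1; funext k
    simp [he]

theorem aeval_conj (g : U n) (a : Mat n) (q : Polynomial ℂ) :
    Polynomial.aeval ((g : Mat n) * a * star (g : Mat n)) q =
      (g : Mat n) * Polynomial.aeval a q * star (g : Mat n) :=
  Polynomial.aeval_algHom_apply
    ((Unitary.conjStarAlgAut ℂ (Mat n) g).toAlgEquiv : Mat n →ₐ[ℂ] Mat n) a q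

end Spectral

/-! ### Functions of temperate growth with Schwartz derivative. -/

section Tame

/-- Functions of temperate growth with Schwartz derivative. -/
def IsTame (f : ℝ → Mat n) : Prop := f.HasTemperateGrowth ∧ IsSchwartz (deriv f)

theorem _root_.Function.HasTemperateGrowth.differentiable {f : ℝ → Mat n}
    (hf : f.HasTemperateGrowth) : Differentiable ℝ f :=
  hf.1.differentiable (by simp)

namespace IsTame

theorem const (c : Mat n) : IsTame fun _ : ℝ => c :=
  ⟨.const c, by simpa using! IsSchwartz.zero (E := Mat n)⟩

theorem add {f g : ℝ → Mat n} (hf : IsTame f) (hg : IsTame g) : IsTame fun x => f x + g x := by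
  refine ⟨hf.1.add hg.1, ?_⟩
  have h : deriv (fun x => f x + g x) = fun x => deriv f x + deriv g x :=
    funext fun x => deriv_fun_add (hf.1.differentiable x) (hg.1.differentiable x)
  rw [h]
  exact hf.2.add hg.2

theorem mul {f g : ℝ → Mat n} (hf : IsTame f) (hg : IsTame g) : IsTame fun x => f x * g x := by
  refine ⟨hf.1.mul hg.1, ?_⟩
  have h : deriv (fun x => f x * g x) = fun x => deriv f x * g x + f x * deriv g x :=
    funext fun x => deriv_fun_mul (hf.1.differentiable x) (hg.1.differentiable x)
  rw [h]
  exact (hf.2.mul_right hg.1).add (hg.2.mul_left hf.1)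

theorem aeval {f : ℝ → Mat n} (hf : IsTame f) (q : Polynomial ℂ) :
    IsTame fun x => Polynomial.aeval (f x) q := by
  induction q using Polynomial.induction_on with
  | C c => simpa using const _
  | add p q hp hq => simpa using hp.add hq
  | monomial m c ih =>
    simp only [pow_succ, ← mul_assoc]
    simpa using ih.mul hf

end IsTame

end Tame

/-! ### Frames: regularity, uniqueness, existence. -/

namespace IsFrame

variable {v : ℝ → Mat n} {g : ℝ → U n}

theorem hasDerivAt (h : IsFrame v g) (x : ℝ) :
    HasDerivAt (fun y => (g y : Mat n)) ((g x : Mat n) * v x) x := by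
  have h1 := h.2.1 x
  rw [coe_inv_unitary] at h1
  have h2 : (g x : Mat n) * v x = deriv (fun y => (g y : Mat n)) x := by
    rw [← h1, ← mul_assoc, mul_star_self_unitary, one_mul]
  rw [h2]
  exact (h.1.differentiable (by simp) x).hasDerivAt

theorem hasDerivAt_star (h : IsFrame v g) (x : ℝ) :
    HasDerivAt (fun y => star (g y : Mat n)) (star (v x) * star (g x : Mat n)) x := by
  rw [← star_mul]
  exact (h.hasDerivAt x).star

theorem tendsto_star (h : IsFrame v g) :
    Filter.Tendsto (fun y => star (g y : Mat n)) Filter.atBot (𝓝 1) := by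
  have := h.2.2.star
  rwa [star_one] at this

theorem hasTemperateGrowth (h : IsFrame v g) (hv : IsSchwartz v) :
    (fun x => (g x : Mat n)).HasTemperateGrowth := by
  obtain ⟨C, hC⟩ := exists_norm_unitary_le n
  exact hasTemperateGrowth_of_hasDerivAt_mul (fun x => hC (g x)) h.hasDerivAt
    hv.hasTemperateGrowth

theorem hasTemperateGrowth_star (h : IsFrame v g) (hv : IsSchwartz v) :
    (fun x => star (g x : Mat n)).HasTemperateGrowth :=
  ((starL' ℝ : Mat n ≃L[ℝ] Mat n).hasTemperateGrowth).comp (h.hasTemperateGrowth hv)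

/-- Since `v` is skew, `g k*` is constant, and its limit at `-∞` is `1`. -/
theorem unique (hvu : ∀ x, v x ∈ u n) {k : ℝ → U n} (hg : IsFrame v g) (hk : IsFrame v k) :
    g = k := by
  have hd : ∀ x, HasDerivAt (fun y => (g y : Mat n) * star (k y : Mat n)) 0 x := fun x => by
    have h := (hg.hasDerivAt x).mul (hk.hasDerivAt_star x)
    rw [mem_u_iff.1 (hvu x)] at h
    refine h.congr_deriv ?_
    noncomm_ring
  have hl := hg.2.2.mul hk.tendsto_star
  rw [mul_one] at hl
  funext x
  have h1 := congrArg (· * (k x : Mat n)) (eq_of_hasDerivAt_zero_of_tendsto hd hl x)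
  simp only [mul_assoc, star_mul_self_unitary, mul_one, one_mul] at h1
  exact Subtype.ext h1

end IsFrame

/-- The matrix solution is unitary because `g g*` has derivative `g (v + v*) g* = 0` and limit `1`.
-/
theorem exists_isFrame {v : ℝ → Mat n} (hv : IsSchwartz v) (hvu : ∀ x, v x ∈ u n) :
    ∃ g : ℝ → U n, IsFrame v g := by
  obtain ⟨C, hC0, hC⟩ := hv.norm_le
  obtain ⟨g, hg, hlim⟩ := exists_hasDerivAt_mul_tendsto_one hC0 hv.hasTemperateGrowth.1.continuous hC
  have hlim' := hlim.star
  rw [star_one] at hlim'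
  have hd : ∀ x, HasDerivAt (fun y => g y * star (g y)) 0 x := fun x => by
    have h := (hg x).mul (hg x).star
    rw [star_mul, mem_u_iff.1 (hvu x)] at h
    refine h.congr_deriv ?_
    noncomm_ring
  have hl := hlim.mul hlim'
  rw [mul_one] at hl
  have hunit : ∀ x, g x ∈ U n := fun x =>
    Matrix.mem_unitaryGroup_iff.2 (eq_of_hasDerivAt_zero_of_tendsto hd hl x)
  obtain ⟨B, hB⟩ := exists_norm_unitary_le n
  refine ⟨fun x => ⟨g x, hunit x⟩, ?_, fun x => ?_, hlim⟩
  · exact (hasTemperateGrowth_of_hasDerivAt_mul (fun x => hB ⟨g x, hunit x⟩) hg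
      hv.hasTemperateGrowth).1
  · rw [coe_inv_unitary]
    change star (g x) * deriv g x = v x
    rw [(hg x).deriv, ← mul_assoc, Matrix.mem_unitaryGroup_iff'.1 (hunit x), one_mul]

/-! ### The centralizer and its orthogonal complement. -/

section Perp

variable {a : Mat n}

theorem commute_of_mem_centralizer {y : Mat n} (hy : y ∈ centralizer a) : Commute y a :=
  sub_eq_zero.1 hy.2

theorem mem_centralizer {y : Mat n} (hy : y ∈ u n) (h : Commute y a) : y ∈ centralizer a :=
  ⟨hy, sub_eq_zero.2 h⟩

open scoped ComplexOrder in
-- For skew `c`, `-tr (c c) = tr (c* c)`. The pairing only sees the real part, so `tr (c c)` must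
-- also be shown real.
theorem eq_zero_of_pairing_self {c : Mat n} (hc : c ∈ u n) (h : pairing c c = 0) : c = 0 := by
  rw [← Matrix.trace_conjTranspose_mul_self_eq_zero_iff, ← Matrix.star_eq_conjTranspose,
    mem_u_iff.1 hc, neg_mul, Matrix.trace_neg, neg_eq_zero]
  have h1 : star (Matrix.trace (c * c)) = Matrix.trace (c * c) := by
    rw [← Matrix.trace_conjTranspose, ← Matrix.star_eq_conjTranspose, star_mul, mem_u_iff.1 hc,
      neg_mul_neg]
  refine Complex.ext (by simpa [pairing] using h) (Complex.conj_eq_iff_im.1 h1)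

theorem conj_mem_u (g : Mat n) {y : Mat n} (hy : y ∈ u n) : g * y * star g ∈ u n := by
  rw [mem_u_iff, star_mul, star_mul, star_star, mem_u_iff.1 hy]
  noncomm_ring

theorem commute_star_unitary {g : U n} (h : Commute (g : Mat n) a) :
    Commute (star (g : Mat n)) a := by
  have h1 : a * star (g : Mat n) = star (g : Mat n) * (g * a) * star (g : Mat n) := by
    rw [← mul_assoc, star_mul_self_unitary, one_mul]
  rw [h.eq, mul_assoc, mul_assoc, mul_star_self_unitary, mul_one] at h1
  exact h1.symm

end Perp

/-! ### Injectivity and range of `Psi`. -/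

/-- A frame is determined by the path `g a g⁻¹` if its generator is orthogonal to the
centralizer of `a`. -/
theorem IsFrame.eq_of_conj_eq {a : Mat n} {v₁ v₂ : ℝ → Mat n} (hv₁ : ∀ x, v₁ x ∈ perp a)
    (hv₂ : ∀ x, v₂ x ∈ perp a) {g₁ g₂ : ℝ → U n} (h₁ : IsFrame v₁ g₁) (h₂ : IsFrame v₂ g₂)
    (h : ∀ x, (g₁ x : Mat n) * a * star (g₁ x : Mat n) = (g₂ x : Mat n) * a * star (g₂ x : Mat n)) :
    g₁ = g₂ := by
  let k : ℝ → U n := fun x => (g₁ x)⁻¹ * g₂ x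
  have hk : ∀ x, (k x : Mat n) = star (g₁ x : Mat n) * g₂ x := fun _ => rfl
  have hcomm : ∀ x, Commute (k x : Mat n) a := fun x => by
    have h1 := congrArg (fun y => star (g₁ x : Mat n) * y * (g₂ x : Mat n)) (h x)
    simp only [mul_assoc, star_mul_self_unitary, mul_one] at h1
    rw [← mul_assoc, star_mul_self_unitary, one_mul] at h1
    change (k x : Mat n) * a = a * k x
    rw [hk, h1, mul_assoc]
  have hkd : ∀ x, HasDerivAt (fun y => (k y : Mat n)) ((k x : Mat n) * v₂ x - v₁ x * k x) x :=
    fun x => by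
      have h := (h₁.hasDerivAt_star x).mul (h₂.hasDerivAt x)
      rw [mem_u_iff.1 (hv₁ x).1] at h
      refine h.congr_deriv ?_
      rw [hk]
      noncomm_ring
  have hzero : ∀ x, (k x : Mat n) * v₂ x - v₁ x * k x = 0 := fun x => by
    set d := (k x : Mat n) * v₂ x - v₁ x * k x with hd
    -- `d` is the derivative of `k`; differentiate `k a = a k`.
    have hda : Commute d a := by
      have e1 := (hkd x).mul_const a
      have e2 := (hkd x).const_mul a
      have : (fun y => (k y : Mat n) * a) = fun y => a * (k y : Mat n) :=
        funext fun y => (hcomm y).eq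
      rw [this] at e1
      exact e1.unique e2
    set c := star (k x : Mat n) * d with hc
    have hc' : c = v₂ x - star (k x : Mat n) * v₁ x * k x := by
      rw [hc, hd, mul_sub, ← mul_assoc, star_mul_self_unitary, one_mul, mul_assoc]
    have hcu : c ∈ u n := by
      rw [hc']
      have := conj_mem_u (star (k x : Mat n)) (hv₁ x).1
      rw [star_star] at this
      exact sub_mem (hv₂ x).1 this
    have hca : Commute c a := (commute_star_unitary (hcomm x)).mul_left hda
    have hp2 : pairing (v₂ x) c = 0 := (hv₂ x).2 c (mem_centralizer hcu hca)
    -- Conjugation by `k` preserves the centralizer, so `k⁻¹ v₁ k` is orthogonal to `c` by cyclicity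
    -- of the trace.
    have hp1 : pairing (v₁ x) (k x * c * star (k x : Mat n)) = 0 :=
      (hv₁ x).2 _ (mem_centralizer (conj_mem_u _ hcu)
        (((hcomm x).mul_left hca).mul_left (commute_star_unitary (hcomm x))))
    have hcc : pairing c c = 0 := by
      have e : pairing (star (k x : Mat n) * v₁ x * (k x : Mat n)) c = 0 := by
        rw [← hp1]
        simp only [pairing, mul_assoc]
        rw [Matrix.trace_mul_comm]
        simp only [mul_assoc]
      have e2 : pairing c c = pairing (v₂ x) c - pairing (star (k x : Mat n) * v₁ x * (k x : Mat n)) c := by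
        conv_lhs => rw [pairing]; arg 1; arg 1; arg 1; arg 1; rw [hc']
        simp only [pairing, sub_mul, Matrix.trace_sub, Complex.sub_re]
        ring
      rw [e2, hp2, e, sub_zero]
    have hc0 := eq_zero_of_pairing_self hcu hcc
    have : d = (k x : Mat n) * c := by rw [hc, ← mul_assoc, mul_star_self_unitary, one_mul]
    rw [this, hc0, mul_zero]
  have hlim : Filter.Tendsto (fun y => (k y : Mat n)) Filter.atBot (𝓝 1) := by
    have := h₁.tendsto_star.mul h₂.2.2
    rwa [mul_one] at this
  funext x
  have h1 : (k x : Mat n) = 1 :=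
    eq_of_hasDerivAt_zero_of_tendsto (fun y => (hkd y).congr_deriv (hzero y)) hlim x
  exact inv_mul_eq_one.1 (Subtype.ext h1 : k x = 1)

theorem IsFrame.conj_mem_pathSpace {a : Mat n} (ha : a ∈ u n) {v : ℝ → Mat n} {g : ℝ → U n}
    (hv : IsSchwartz v) (hvu : ∀ x, v x ∈ u n) (h : IsFrame v g) :
    (fun x => (g x : Mat n) * a * star (g x : Mat n)) ∈ pathSpace a := by
  have hg := h.hasTemperateGrowth hv
  have hg' := h.hasTemperateGrowth_star hv
  have hd : ∀ x, deriv (fun y => (g y : Mat n) * a * star (g y : Mat n)) x =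
      (g x : Mat n) * (v x * a - a * v x) * star (g x : Mat n) := fun x => by
    have e := ((h.hasDerivAt x).mul_const a).mul (h.hasDerivAt_star x)
    rw [mem_u_iff.1 (hvu x)] at e
    refine e.deriv.trans ?_
    noncomm_ring
  refine ⟨fun x => ⟨g x, rfl⟩, ((hg.1.mul contDiff_const).mul hg'.1), ?_, ?_⟩
  · have := (h.2.2.mul_const a).mul h.tendsto_star
    rwa [one_mul, mul_one] at this
  · refine IsSchwartz.codRestrict (u n) ?_ fun x => ?_
    · rw [funext hd]
      refine IsSchwartz.mul_right (IsSchwartz.mul_left ?_ hg) hg'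
      have hca := Function.HasTemperateGrowth.const (E := ℝ) a
      have hca' := Function.HasTemperateGrowth.const (E := ℝ) (-a)
      simpa [sub_eq_add_neg] using (hv.mul_right hca).add (hv.mul_left hca')
    · rw [hd]
      refine conj_mem_u _ ?_
      rw [mem_u_iff, star_sub, star_mul, star_mul, mem_u_iff.1 ha, mem_u_iff.1 (hvu x)]
      noncomm_ring

/-! ### Surjectivity of `Psi`. -/

theorem isTame_of_mem_pathSpace {a : Mat n} {γ : ℝ → Mat n} (hγ : γ ∈ pathSpace a) :
    IsTame γ := by
  obtain ⟨ho, hs, -, s, hd⟩ := hγ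
  have hS : IsSchwartz (deriv γ) := by
    rw [funext hd]
    exact (IsSchwartz.of_schwartzMap s).clm (u n).subtypeL
  refine ⟨hasTemperateGrowth_of_deriv (C := ‖a‖) (hs.differentiable (by simp)) (fun x => ?_)
    hS.hasTemperateGrowth, hS⟩
  -- The operator norm is constant on the orbit.
  obtain ⟨g, hg⟩ := ho x
  rw [hg, CStarRing.norm_mul_coe_unitary, CStarRing.norm_coe_unitary_mul]

/-- If `z` commutes with a complete family of idempotents `q_i` and `v` has no diagonal blocks,
then `tr (v z) = 0`. -/
theorem trace_mul_eq_zero {ι : Type*} {S : Finset ι} {q : ι → Mat n} {v z : Mat n}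
    (hq : ∀ i ∈ S, q i * q i = q i) (hsum : ∑ i ∈ S, q i = 1) (hv : ∀ i ∈ S, q i * v * q i = 0)
    (hz : ∀ i ∈ S, Commute z (q i)) : Matrix.trace (v * z) = 0 := by
  have h : v * z = ∑ i ∈ S, v * (q i * z * q i) := by
    rw [← Finset.mul_sum, Finset.sum_congr rfl fun i hi => by
      rw [← (hz i hi).eq, mul_assoc, hq i hi], ← Finset.mul_sum, hsum, mul_one]
  rw [h, Matrix.trace_sum]
  refine Finset.sum_eq_zero fun i hi => ?_
  rw [← mul_assoc, Matrix.trace_mul_comm, ← mul_assoc, ← mul_assoc, hv i hi, zero_mul,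
    Matrix.trace_zero]

/-- Every path in the orbit lifts to a Schwartz curve orthogonal to the centralizer. -/
theorem exists_isFrame_of_mem_pathSpace {a : Mat n} (ha : a ∈ u n) {γ : ℝ → Mat n}
    (hγ : γ ∈ pathSpace a) :
    ∃ (v : ℝ → Mat n) (g : ℝ → U n), IsSchwartz v ∧ (∀ x, v x ∈ perp a) ∧ IsFrame v g ∧
      ∀ x, γ x = (g x : Mat n) * a * star (g x : Mat n) := by
  obtain ⟨S, l, hmul, hstar, hsum, hsmul⟩ := exists_spectral_polynomials ha
  have htame := isTame_of_mem_pathSpace hγ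
  -- As `γ x` is conjugate to `a`, the same polynomials give its spectral projections, so `P i`
  -- inherits tameness from `γ`.
  let P : ℂ → ℝ → Mat n := fun i x => Polynomial.aeval (γ x) (l i)
  have hPt : ∀ i, IsTame (P i) := fun i => htame.aeval (l i)
  have hPd : ∀ i x, HasDerivAt (P i) (deriv (P i) x) x := fun i x =>
    ((hPt i).1.differentiable x).hasDerivAt
  choose r hr using hγ.1
  have hr' : ∀ x, γ x = (r x : Mat n) * a * star (r x : Mat n) := hr
  have hPr : ∀ i x, P i x = (r x : Mat n) * Polynomial.aeval a (l i) * star (r x : Mat n) :=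
    fun i x => by
      change Polynomial.aeval (γ x) (l i) = _
      rw [hr' x, aeval_conj]
  have hPP : ∀ x, ∀ i ∈ S, ∀ j ∈ S, P i x * P j x = if i = j then P i x else 0 := by
    intro x i hi j hj
    have : P i x * P j x = (r x : Mat n) *
        (Polynomial.aeval a (l i) * Polynomial.aeval a (l j)) * star (r x : Mat n) := by
      rw [hPr, hPr]
      simp only [mul_assoc]
      rw [← mul_assoc (star (r x : Mat n)) (r x : Mat n), star_mul_self_unitary, one_mul]
    rw [this, hmul i hi j hj, hPr]
    split_ifs <;> simp
  have hPstar : ∀ x, ∀ i ∈ S, star (P i x) = P i x := by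
    intro x i hi
    rw [hPr, star_mul, star_mul, star_star, hstar i hi, mul_assoc]
  have hPsum : ∀ x, ∑ i ∈ S, P i x = 1 := fun x => by
    simp only [hPr]
    rw [← Finset.sum_mul, ← Finset.mul_sum, hsum, mul_one, mul_star_self_unitary]
  have hPsmul : ∀ x, ∑ i ∈ S, i • P i x = γ x := fun x => by
    simp only [hPr]
    rw [hr' x]
    conv_rhs => rw [← hsmul]
    rw [Finset.mul_sum, Finset.sum_mul]
    exact Finset.sum_congr rfl fun i _ => by rw [mul_smul_comm, smul_mul_assoc]
  have hd : ∀ x, ∀ i ∈ S, ∀ j ∈ S, deriv (P i) x * P j x + P i x * deriv (P j) x =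
      if i = j then deriv (P i) x else 0 := by
    intro x i hi j hj
    have h1 := (hPd i x).mul (hPd j x)
    have h2 : P i * P j = fun y => if i = j then P i y else 0 :=
      funext fun y => hPP y i hi j hj
    rw [h2] at h1
    split_ifs at h1 ⊢ with hij
    · exact h1.unique (hPd i x)
    · exact h1.unique (hasDerivAt_const x 0)
  have hdstar : ∀ x, ∀ i ∈ S, star (deriv (P i) x) = deriv (P i) x := by
    intro x i hi
    have h1 := (hPd i x).star
    rw [show (fun y => star (P i y)) = P i from funext fun y => hPstar y i hi] at h1
    exact h1.unique (hPd i x)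
  have hdsum : ∀ x, ∑ i ∈ S, deriv (P i) x = 0 := fun x => by
    have h1 := HasDerivAt.fun_sum fun i (_ : i ∈ S) => hPd i x
    rw [funext hPsum] at h1
    exact h1.unique (hasDerivAt_const x 1)
  have hdγ : ∀ x, HasDerivAt γ (∑ i ∈ S, i • deriv (P i) x) x := fun x => by
    have h1 := HasDerivAt.fun_sum fun i (_ : i ∈ S) => (hPd i x).const_smul i
    exact (funext hPsmul : (fun x => ∑ i ∈ S, i • P i x) = γ) ▸ h1
  let w : ℝ → Mat n := fun x => ∑ i ∈ S, deriv (P i) x * P i x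
  have hwS : IsSchwartz w := IsSchwartz.sum fun i _ => (hPt i).2.mul_right (hPt i).1
  have hwu : ∀ x, star (w x) = -w x := fun x =>
    star_kato (hd x) (hPstar x) (hdstar x) (hdsum x)
  have hwγ : ∀ x, w x * γ x - γ x * w x = ∑ i ∈ S, i • deriv (P i) x := fun x => by
    rw [← hPsmul x, Finset.mul_sum, Finset.sum_mul, ← Finset.sum_sub_distrib]
    refine Finset.sum_congr rfl fun i hi => ?_
    rw [mul_smul_comm, smul_mul_assoc, ← smul_sub]
    exact congrArg (i • ·) (kato_commutator (hPP x) (hPsum x) (hd x) hi)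
  have hnS : IsSchwartz fun x => -w x := by
    simpa using hwS.clm (-ContinuousLinearMap.id ℝ (Mat n))
  -- With `k' = -k w`, the derivative of `k γ k*` is `k (γ' - [w, γ]) k* = 0`.
  obtain ⟨k, hk⟩ := exists_isFrame hnS fun x => neg_mem (mem_u_iff.2 (hwu x))
  have hks : ∀ x, HasDerivAt (fun y => star (k y : Mat n)) (w x * star (k x : Mat n)) x :=
    fun x => (hk.hasDerivAt_star x).congr_deriv (by rw [star_neg, hwu, neg_neg])
  have hkγ : ∀ x, (k x : Mat n) * γ x * star (k x : Mat n) = a := by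
    refine eq_of_hasDerivAt_zero_of_tendsto (fun x => ?_) ?_
    · refine (((hk.hasDerivAt x).mul (hdγ x)).mul (hks x)).congr_deriv ?_
      rw [← hwγ x]
      simp only [Pi.mul_apply]
      noncomm_ring
    · have := (hk.2.2.mul hγ.2.2.1).mul hk.tendsto_star
      rwa [one_mul, mul_one] at this
  have htg := hk.hasTemperateGrowth hnS
  have htg' := hk.hasTemperateGrowth_star hnS
  -- The frame is `g = k⁻¹ = k*`, so `g⁻¹ g' = k (k*)' = k w k*`.
  refine ⟨fun x => (k x : Mat n) * w x * star (k x : Mat n), fun x => (k x)⁻¹,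
    (hwS.mul_left htg).mul_right htg', fun x => ⟨conj_mem_u _ (mem_u_iff.2 (hwu x)), ?_⟩,
    ⟨htg'.1, fun x => ?_, hk.tendsto_star⟩, fun x => ?_⟩
  · intro z hz
    have hq : ∀ i, Polynomial.aeval a (l i) = (k x : Mat n) * P i x * star (k x : Mat n) :=
      fun i => by rw [← hkγ x, aeval_conj]
    -- Conjugation by `k` turns `P i` into the projections of `a`, for which `k w k*` has zero
    -- diagonal blocks; `z` commutes with them as polynomials in `a`.
    have h0 : Matrix.trace ((k x : Mat n) * w x * star (k x : Mat n) * z) = 0 := by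
      refine trace_mul_eq_zero (fun i hi => by simpa using hmul i hi i hi) hsum (fun i hi => ?_)
        fun i _ => ?_
      · have h1 : Polynomial.aeval a (l i) * ((k x : Mat n) * w x * star (k x : Mat n)) *
            Polynomial.aeval a (l i) =
            (k x : Mat n) * (P i x * w x * P i x) * star (k x : Mat n) := by
          have h2 : ∀ y : Mat n, star (k x : Mat n) * ((k x : Mat n) * y) = y := fun y => by
            rw [← mul_assoc, star_mul_self_unitary, one_mul]
          rw [hq]
          simp only [mul_assoc, h2]
        rw [h1, kato_diagonal (hPP x) (hd x) hi, mul_zero, zero_mul]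
      · rw [Polynomial.aeval_eq_sum_range]
        exact Commute.sum_right _ _ _ fun m _ =>
          ((commute_of_mem_centralizer hz).pow_right m).smul_right _
    rw [pairing, h0, Complex.zero_re, neg_zero]
  · rw [inv_inv]
    change (k x : Mat n) * deriv (fun y => star (k y : Mat n)) x = _
    rw [(hks x).deriv, ← mul_assoc]
  · change _ = star (k x : Mat n) * a * star (star (k x : Mat n))
    rw [star_star, ← hkγ x]
    simp only [mul_assoc, star_mul_self_unitary, mul_one]
    rw [← mul_assoc, star_mul_self_unitary, one_mul]

theorem existsUnique_isFrame {a : Mat n} (v : SchwartzPerp a) :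
    ∃! g : ℝ → U n, IsFrame (fun x => (v x : Mat n)) g := by
  obtain ⟨g, hg⟩ := exists_isFrame ((IsSchwartz.of_schwartzMap v).clm (perp a).subtypeL)
    fun x => (v x).2.1
  exact ⟨g, hg, fun k hk => IsFrame.unique (fun x => (v x).2.1) hk hg⟩

theorem isFrame_frame {a : Mat n} (v : SchwartzPerp a) :
    IsFrame (fun x => (v x : Mat n)) (frame fun x => (v x : Mat n)) :=
  Classical.epsilon_spec (existsUnique_isFrame v).exists

theorem bijOn_Psi {a : Mat n} (ha : a ∈ u n) :
    Set.BijOn (Psi a) Set.univ (pathSpace a) := by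
  refine ⟨fun v _ => ?_, fun v₁ _ v₂ _ h => ?_, fun γ hγ => ?_⟩
  · exact (isFrame_frame v).conj_mem_pathSpace ha
      ((IsSchwartz.of_schwartzMap v).clm (perp a).subtypeL) fun x => (v x).2.1
  · have hg := IsFrame.eq_of_conj_eq (fun x => (v₁ x).2) (fun x => (v₂ x).2)
      (isFrame_frame v₁) (isFrame_frame v₂) (congrFun h)
    ext1 x
    have h1 := (isFrame_frame v₁).2.1 x
    rw [hg, (isFrame_frame v₂).2.1 x] at h1
    exact Subtype.ext h1.symm
  · obtain ⟨v, g, hv, hvp, hg, hγg⟩ := exists_isFrame_of_mem_pathSpace ha hγ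
    obtain ⟨s, hs⟩ := hv.codRestrict (perp a) hvp
    refine ⟨s, Set.mem_univ s, funext fun x => ?_⟩
    have hgs : IsFrame (fun x => (s x : Mat n)) g := by rwa [← funext hs]
    have : frame (fun x => (s x : Mat n)) = g :=
      IsFrame.unique (fun x => (s x).2.1) (isFrame_frame s) hgs
    rw [hγg x, Psi, this, coe_inv_unitary]

end AdjointOrbit

theorem theorem3p1 (n : ℕ) (a : AdjointOrbit.Mat n) (ha : a ∈ AdjointOrbit.u n) :
    (∀ v : AdjointOrbit.SchwartzPerp a,
      ∃! g : ℝ → AdjointOrbit.U n, AdjointOrbit.IsFrame (fun x => (v x : AdjointOrbit.Mat n)) g) ∧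
    Set.BijOn (AdjointOrbit.Psi a) Set.univ (AdjointOrbit.pathSpace a) ∧
    Set.InvOn (AdjointOrbit.developmentMap a) (AdjointOrbit.Psi a) Set.univ
      (AdjointOrbit.pathSpace a) := by
  have hbij := AdjointOrbit.bijOn_Psi ha
  refine ⟨AdjointOrbit.existsUnique_isFrame, hbij, fun v _ => ?_, fun γ hγ => ?_⟩
  · exact Function.leftInverse_invFun (Set.injOn_univ.1 hbij.injOn) v
  · obtain ⟨v, -, hv⟩ := hbij.surjOn hγ
    exact Function.invFun_eq ⟨v, hv⟩
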